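/- Let $\mathbb H$ be a separable real Hilbert space with origin $0$, let $\alpha>0$, and let $X$ be a random element of $\mathbb H$ which is regularly varying with index $\alpha$. That is, there are a regularly varying function $b$ (measurable, with $b(tx)/b(t)\to x^{\rho}$ as $t\to\infty$ for all $x>0$, for some $\rho\in\mathbb R$) and a nonzero Borel measure $\mu$ on $\mathbb H\setminus\{0\}$, finite on Borel sets bounded away from $0$, such that $\mu(tA)=t^{-\alpha}\mu(A)$ for all $t>0$ and all Borel sets $A\subseteq\mathbb H\setminus\{0\}$, and $b(n)\,\mathbb E[f(X/n)]\to\int f\,d\mu$ as $n\to\infty$ for every bounded continuous $f:\mathbb H\setminus\{0\}\to\mathbb R$ vanishing in a neighbourhood of $0$ (where $f(0):=0$). Then $X$ has a limit angular measure: a probability measure $P_{\Theta,\infty}$ on the unit sphere of $\mathbb H$ such that the conditional laws $P_{\Theta,t}=\mathbb P[X/\|X\|\in\cdot\,\mid\,\|X\|>t]$ converge weakly to $P_{\Theta,\infty}$ as $t\to\infty$. Let $C_\infty=\mathbb E[\Theta_\infty\otimes\Theta_\infty]$ with $\Theta_\infty\sim P_{\Theta,\infty}$, where $h\otimes h$ is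 the operator $x\mapsto\langle h,x\rangle h$. Let $X_1,X_2,\dots$ be independent random elements distributed as $X$. For each $n$ let $X_{(1)},\dots,X_{(n)}$ be a permutation of $X_1,\dots,X_n$ with $\|X_{(1)}\|\ge\dots\ge\|X_{(n)}\|$ (ties broken in any way), let $\Theta_{(i)}=X_{(i)}/\|X_{(i)}\|$ (and $\Theta_{(i)}=0$ if $X_{(i)}=0$), and for $1\le k\le n$ let $$\widehat C_k=\frac1k\sum_{i=1}^k\Theta_{(i)}\otimes\Theta_{(i)}.$$ Then, as $n,k\to\infty$ with $k/n\to0$, $$\|\widehat C_k-C_\infty\|_{HS(\mathbb H)}\to0\quad\text{in probability},$$ where $\|A\|_{HS(\mathbb H)}=(\sum_i\|Ae_i\|^2)^{1/2}$ for any orthonormal basis $(e_i)$ of $\mathbb H$. -/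

import Mathlib

open MeasureTheory ProbabilityTheory Filter Topology
open scoped ENNReal Pointwise BoundedContinuousFunction

section RegularVariation

variable {H : Type*} [NormedAddCommGroup H] [InnerProductSpace ℝ H] [MeasurableSpace H]

/-- A measurable function `f : ℝ → ℝ` is regularly varying (at infinity) with index `ρ`. -/
def IsRegularlyVaryingFun (f : ℝ → ℝ) (ρ : ℝ) : Prop :=
  Measurable f ∧ ∀ x : ℝ, 0 < x → Tendsto (fun t : ℝ => f (t * x) / f t) atTop (𝓝 (x ^ ρ))

/-- The class `M₀` of Borel measures on `H \ {0}` which are finite on sets bounded away from `0`.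
A measure on `H \ {0}` is seen as a measure on `H` that gives no mass to `{0}`. -/
def MemMZero (μ : Measure H) : Prop :=
  μ {0} = 0 ∧ ∀ r : ℝ, 0 < r → μ {x : H | r ≤ ‖x‖} < ∞

/-- Convergence in `M₀`: convergence of the integrals of all bounded continuous functions which
vanish in a neighbourhood of `0`. (Such functions on `H \ {0}` are exactly the restrictions of such
functions on `H`.) -/
def TendstoMZero (μs : ℕ → Measure H) (μ : Measure H) : Prop :=
  ∀ f : H →ᵇ ℝ, (∀ᶠ x in 𝓝 (0 : H), f x = 0) →
    Tendsto (fun n => ∫ x, f x ∂(μs n)) atTop (𝓝 (∫ x, f x ∂μ))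

/-- The distribution `ν` of a random element of `H` is regularly varying with index `α` (that is,
`ν ∈ RV_{-α}`): for some nonzero `μ ∈ M₀` and some regularly varying function `b`, the measures
`b(n) ν(n ·)` converge to `μ` in `M₀`, and `μ (t A) = t ^ (-α) μ (A)` for all `t > 0` and all Borel
sets `A ⊆ H \ {0}`. The measure `ν(n ·)` is the image of `ν` under `x ↦ n⁻¹ x`. -/
def IsRegularlyVarying (ν : Measure H) (α : ℝ) : Prop :=
  ∃ (μ : Measure H) (b : ℝ → ℝ) (ρ : ℝ),
    MemMZero μ ∧ μ ≠ 0 ∧ IsRegularlyVaryingFun b ρ ∧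
    TendstoMZero
      (fun n : ℕ => ENNReal.ofReal (b n) • ν.map (fun x : H => (n : ℝ)⁻¹ • x)) μ ∧
    ∀ t : ℝ, 0 < t → ∀ A : Set H, MeasurableSet A → (0 : H) ∉ A →
      μ (t • A) = ENNReal.ofReal (t ^ (-α)) * μ A

/-- The angle `θ(x) = x / ‖x‖` of a nonzero `x` (with value `0` at `x = 0`). -/
noncomputable def angle (x : H) : H := ‖x‖⁻¹ • x

/-- If `X` has distribution `ν`, this is `P_{Θ,t}`, the distribution of the angle `Θ = X / ‖X‖`
conditionally on `‖X‖ > t`. -/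
noncomputable def angularLaw (ν : Measure H) (t : ℝ) : Measure H :=
  (cond ν {x : H | t < ‖x‖}).map angle

/-- `Q` is the limit angular measure of `ν`: a probability measure carried by the unit sphere to
which `P_{Θ,t}` converges weakly as `t → ∞`. -/
def IsLimitAngularMeasure (ν Q : Measure H) : Prop :=
  IsProbabilityMeasure Q ∧ Q (Metric.sphere (0 : H) 1)ᶜ = 0 ∧
    ∀ f : H →ᵇ ℝ,
      Tendsto (fun t : ℝ => ∫ x, f x ∂(angularLaw ν t)) atTop (𝓝 (∫ x, f x ∂Q))

end RegularVariation

section Covariance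

variable {H : Type*} [NormedAddCommGroup H] [InnerProductSpace ℝ H]

/-- The operator `h ⊗ h : x ↦ ⟪h, x⟫ h`. -/
noncomputable def tensorSq (h : H) : H →L[ℝ] H := InnerProductSpace.rankOne ℝ h h

/-- The (uncentred) covariance operator `E[Θ ⊗ Θ]`, for `Θ` with distribution `Q`. -/
noncomputable def covOp [MeasurableSpace H] (Q : Measure H) : H →L[ℝ] H :=
  ∫ θ, tensorSq θ ∂Q

/-- The Hilbert–Schmidt norm `(∑ᵢ ‖A eᵢ‖²)^{1/2}`, infinite when `A` is not a Hilbert–Schmidt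
operator; its value does not depend on the orthonormal basis `e`. -/
noncomputable def hsNorm {ι : Type*} (e : HilbertBasis ι ℝ H) (A : H →L[ℝ] H) : ℝ≥0∞ :=
  (∑' i, ‖A (e i)‖ₑ ^ 2) ^ (1 / 2 : ℝ)

/-- `σ` orders the sample `x` by nonincreasing norm: `x (σ 0), x (σ 1), …` are
`x₍₁₎, x₍₂₎, …`, with ties broken in any way. -/
def OrdersByNorm {n : ℕ} (x : Fin n → H) (σ : Equiv.Perm (Fin n)) : Prop :=
  Antitone fun i => ‖x (σ i)‖

/-- The empirical covariance `k⁻¹ ∑_{i ≤ k} Θ₍ᵢ₎ ⊗ Θ₍ᵢ₎` of the angles of the `k` first elements of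
the sample `x` in the order given by `σ`. -/
noncomputable def empCov {n : ℕ} (x : Fin n → H) (σ : Equiv.Perm (Fin n)) (k : ℕ) : H →L[ℝ] H :=
  (k : ℝ)⁻¹ • ∑ i ∈ Finset.univ.filter (fun i : Fin n => i.val < k), tensorSq (angle (x (σ i)))

end Covariance

/-! Angular limit. Write `T f t` for the integral of `f(θ(x))` over `‖x‖ > t` under `ν`, and `V = T
1`. The angle is scale invariant and `μ` is homogeneous, so regular variation gives `b(n) T f (nr) →
r^(-α) G f` for `f ≥ 0`, where `G f` is the integral of `f(θ(x))` over `‖x‖ > 1` under `μ`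
(`tendsto_mul_tailIntegral`). Dividing by the case `f = 1` eliminates `b`: the ratios `T f / V`
converge, and `Q` is the angular law of `μ` beyond radius `1`. The same limits give `V(n+1)/V(n) →
1`.

Weak consistency. Hence some deterministic levels `u` satisfy `n V(u) / k → 1`, even if `V` has
jumps. By Chebyshev, the sum of `f(θ)` over the points beyond `u`, divided by `k`, tends to `∫ f dQ`
in probability; with `f = 1`, the number of such points is asymptotic to `k`. The `k` largest points
and the points beyond `u` are nested sets, so replacing one by the other costs `o(k)`.

Hilbert–Schmidt norm. This yields convergence of each matrix entry. There is no loss of mass in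
infinitely many directions: the limit has trace exactly `1` and the empirical operators have trace
at most `1`, so closeness on a large finite block forces both traces off the block to be small. For
positive contractions the trace dominates the squared columns, and `hsNorm_sub_le` reduces the norm
to finitely many entries. -/

theorem measurableSet_lt_norm {H : Type*} [NormedAddCommGroup H] [MeasurableSpace H] [BorelSpace H]
    (t : ℝ) : MeasurableSet {x : H | t < ‖x‖} :=
  measurableSet_lt measurable_const measurable_norm

/-! ### Angles and continuous radial cut-offs -/

section Angle

variable {H : Type*} [NormedAddCommGroup H] [InnerProductSpace ℝ H]

theorem norm_angle_of_ne_zero {x : H} (hx : x ≠ 0) : ‖angle x‖ = 1 := by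
  rw [angle, norm_smul, norm_inv, norm_norm, inv_mul_cancel₀ (norm_ne_zero_iff.2 hx)]

theorem norm_angle_le_one (x : H) : ‖angle x‖ ≤ 1 := by
  by_cases hx : x = 0
  · simp [angle, hx]
  · exact (norm_angle_of_ne_zero hx).le

theorem angle_smul {c : ℝ} (hc : 0 < c) (x : H) : angle (c • x) = angle x := by
  rw [angle, angle, norm_smul, Real.norm_of_nonneg hc.le, smul_smul, mul_inv, mul_comm c⁻¹,
    mul_assoc, inv_mul_cancel₀ hc.ne', mul_one]

theorem continuousAt_angle {x : H} (hx : x ≠ 0) : ContinuousAt angle x :=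
  (continuousAt_id.norm.inv₀ (norm_ne_zero_iff.2 hx)).smul continuousAt_id

theorem measurable_angle [MeasurableSpace H] [BorelSpace H] [SecondCountableTopology H] :
    Measurable (angle : H → H) :=
  measurable_norm.inv.smul measurable_id

end Angle

section Ramp

/-- The continuous piecewise linear function equal to `0` before `r` and to `1` after `s`. -/
noncomputable def ramp (r s y : ℝ) : ℝ := max 0 (min 1 ((y - r) / (s - r)))

theorem ramp_nonneg (r s y : ℝ) : 0 ≤ ramp r s y := le_max_left _ _

theorem ramp_le_one (r s y : ℝ) : ramp r s y ≤ 1 := max_le zero_le_one (min_le_left _ _)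

theorem ramp_eq_zero {r s y : ℝ} (hrs : r < s) (hy : y ≤ r) : ramp r s y = 0 :=
  max_eq_left (min_le_of_right_le (div_nonpos_of_nonpos_of_nonneg (by linarith) (by linarith)))

theorem ramp_eq_one {r s y : ℝ} (hrs : r < s) (hy : s ≤ y) : ramp r s y = 1 := by
  rw [ramp, min_eq_left, max_eq_right zero_le_one]
  rw [le_div_iff₀ (by linarith)]
  linarith

theorem continuous_ramp (r s : ℝ) : Continuous (ramp r s) := by
  unfold ramp
  fun_prop

variable {H : Type*} [NormedAddCommGroup H] [InnerProductSpace ℝ H]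

theorem continuous_ramp_norm_mul_angle (f : H →ᵇ ℝ) {r s : ℝ} (hr : 0 < r) (hrs : r < s) :
    Continuous fun x : H => ramp r s ‖x‖ * f (angle x) := by
  rw [continuous_iff_continuousAt]
  intro x
  by_cases hx : x = 0
  · subst hx
    have h : (fun x : H => ramp r s ‖x‖ * f (angle x)) =ᶠ[𝓝 0] fun _ => 0 := by
      filter_upwards [Metric.ball_mem_nhds (0 : H) hr] with x hx
      rw [mem_ball_zero_iff] at hx
      rw [ramp_eq_zero hrs hx.le, zero_mul]
    exact continuousAt_const.congr h.symm
  · exact ((continuous_ramp r s).comp continuous_norm).continuousAt.mul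
      (f.continuous.continuousAt.comp (continuousAt_angle hx))

/-- The bounded continuous function `x ↦ w(‖x‖) f(x / ‖x‖)`, where the weight `w` vanishes before
`r` and is `1` after `s`. -/
noncomputable def rampAngle (f : H →ᵇ ℝ) {r s : ℝ} (hr : 0 < r) (hrs : r < s) : H →ᵇ ℝ :=
  BoundedContinuousFunction.ofNormedAddCommGroup (fun x : H => ramp r s ‖x‖ * f (angle x))
    (continuous_ramp_norm_mul_angle f hr hrs) ‖f‖ fun x => by
      rw [norm_mul, Real.norm_of_nonneg (ramp_nonneg _ _ _)]
      exact (mul_le_of_le_one_left (norm_nonneg _) (ramp_le_one _ _ _)).trans (f.norm_coe_le_norm _)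

@[simp] theorem rampAngle_apply (f : H →ᵇ ℝ) {r s : ℝ} (hr : 0 < r) (hrs : r < s) (x : H) :
    rampAngle f hr hrs x = ramp r s ‖x‖ * f (angle x) := rfl

theorem rampAngle_eventually_eq_zero (f : H →ᵇ ℝ) {r s : ℝ} (hr : 0 < r) (hrs : r < s) :
    ∀ᶠ x in 𝓝 (0 : H), rampAngle f hr hrs x = 0 := by
  filter_upwards [Metric.ball_mem_nhds (0 : H) hr] with x hx
  rw [mem_ball_zero_iff] at hx
  rw [rampAngle_apply, ramp_eq_zero hrs hx.le, zero_mul]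

end Ramp

/-! ### Tail integrals of angular functions and homogeneity -/

section TailIntegral

theorem MemMZero.measure_lt_norm_ne_top {H : Type*} [NormedAddCommGroup H] [MeasurableSpace H]
    {μ : Measure H} (hμ : MemMZero μ) {r : ℝ} (hr : 0 < r) :
    μ {x : H | r < ‖x‖} ≠ ∞ :=
  ((measure_mono fun _ (hx : r < ‖_‖) => hx.le).trans_lt (hμ.2 r hr)).ne

variable {H : Type*} [NormedAddCommGroup H] [InnerProductSpace ℝ H] [MeasurableSpace H]

/-- The integral of `f(x / ‖x‖)` over `‖x‖ > t`. -/
noncomputable def tailIntegral (m : Measure H) (f : H →ᵇ ℝ) (t : ℝ) : ℝ :=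
  ∫ x in {x : H | t < ‖x‖}, f (angle x) ∂m

theorem tailIntegral_nonneg (m : Measure H) {f : H →ᵇ ℝ} (hf : 0 ≤ f) (t : ℝ) :
    0 ≤ tailIntegral m f t :=
  integral_nonneg fun _ => hf _

theorem tailIntegral_one (m : Measure H) (t : ℝ) :
    tailIntegral m (1 : H →ᵇ ℝ) t = m.real {x : H | t < ‖x‖} := by
  simp [tailIntegral]

variable [BorelSpace H]

theorem tailIntegral_eq_integral_indicator (m : Measure H) (f : H →ᵇ ℝ) (t : ℝ) :
    tailIntegral m f t = ∫ x, {x : H | t < ‖x‖}.indicator (fun x => f (angle x)) x ∂m :=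
  (integral_indicator (measurableSet_lt_norm t)).symm

variable [SecondCountableTopology H]

theorem integrableOn_comp_angle {m : Measure H} (f : H →ᵇ ℝ) {s : Set H} (hs : m s ≠ ∞) :
    IntegrableOn (fun x => f (angle x)) s m :=
  Measure.integrableOn_of_bounded (M := ‖f‖) hs
    (f.continuous.measurable.comp measurable_angle).aestronglyMeasurable
    (ae_of_all _ fun _ => f.norm_coe_le_norm _)

theorem tailIntegral_anti {m : Measure H} {f : H →ᵇ ℝ} (hf : 0 ≤ f) {s t : ℝ}
    (hs : m {x : H | s < ‖x‖} ≠ ∞) (hst : s ≤ t) : tailIntegral m f t ≤ tailIntegral m f s :=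
  setIntegral_mono_set (integrableOn_comp_angle f hs) (ae_of_all _ fun _ => hf _)
    (ae_of_all _ fun _ (hx : t < ‖_‖) => hst.trans_lt hx)

/-- The ramp lies between the indicators of `[s, ∞)` and `(r, ∞)`, so an admissible test function
brackets integrals with a sharp threshold. -/
theorem integral_rampAngle_comp_smul_mem_Icc {m : Measure H} {f : H →ᵇ ℝ} (hf : 0 ≤ f) {r s c : ℝ}
    (hr : 0 < r) (hrs : r < s) (hc : 0 < c) (hm : m {x : H | c * r < ‖x‖} ≠ ∞) :
    ∫ x, rampAngle f hr hrs (c⁻¹ • x) ∂m ∈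
      Set.Icc (tailIntegral m f (c * s)) (tailIntegral m f (c * r)) := by
  have hle : ∀ x, rampAngle f hr hrs (c⁻¹ • x) ≤
      {x : H | c * r < ‖x‖}.indicator (fun x => f (angle x)) x := by
    intro x
    rw [rampAngle_apply, angle_smul (inv_pos.2 hc), norm_smul,
      Real.norm_of_nonneg (inv_pos.2 hc).le]
    by_cases hx : c * r < ‖x‖
    · rw [Set.indicator_of_mem (by exact hx)]
      exact mul_le_of_le_one_left (hf _) (ramp_le_one _ _ _)
    · rw [Set.indicator_of_notMem (by exact hx), ramp_eq_zero hrs, zero_mul]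
      rw [inv_mul_le_iff₀ hc]
      exact not_lt.1 hx
  have hnn : ∀ x, 0 ≤ rampAngle f hr hrs x := fun x => mul_nonneg (ramp_nonneg _ _ _) (hf _)
  have hi := (integrable_indicator_iff (measurableSet_lt_norm _)).2 (integrableOn_comp_angle f hm)
  have hint : Integrable (fun x => rampAngle f hr hrs (c⁻¹ • x)) m := by
    refine hi.mono' ?_ (ae_of_all _ fun x => ?_)
    · exact ((rampAngle f hr hrs).continuous.comp
        (continuous_const_smul c⁻¹)).measurable.aestronglyMeasurable
    · rw [Real.norm_of_nonneg (hnn _)]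
      exact hle x
  rw [tailIntegral_eq_integral_indicator, tailIntegral_eq_integral_indicator]
  refine ⟨integral_mono_of_nonneg (ae_of_all _ fun x => Set.indicator_nonneg (fun _ _ => hf _) x)
    hint (ae_of_all _ fun x => ?_), integral_mono hint hi hle⟩
  by_cases hx : c * s < ‖x‖
  · rw [Set.indicator_of_mem (by exact hx)]
    beta_reduce
    rw [rampAngle_apply, angle_smul (inv_pos.2 hc), norm_smul,
      Real.norm_of_nonneg (inv_pos.2 hc).le, ramp_eq_one hrs, one_mul]
    rw [le_inv_mul_iff₀ hc]
    exact hx.le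
  · rw [Set.indicator_of_notMem (by exact hx)]
    exact hnn _

/-- Homogeneity is known only for sets avoiding the origin; the origin is null for both measures and
can be removed. -/
theorem map_inv_smul_eq_smul {μ : Measure H} {α : ℝ} (h0 : μ {0} = 0)
    (hhom : ∀ t : ℝ, 0 < t → ∀ A : Set H, MeasurableSet A → (0 : H) ∉ A →
      μ (t • A) = ENNReal.ofReal (t ^ (-α)) * μ A) {t : ℝ} (ht : 0 < t) :
    μ.map (fun x : H => t⁻¹ • x) = ENNReal.ofReal (t ^ (-α)) • μ := by
  have hmeas : Measurable fun x : H => t⁻¹ • x := measurable_const_smul t⁻¹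
  have hmap : ∀ A : Set H, MeasurableSet A → μ.map (fun x : H => t⁻¹ • x) A = μ (t • A) := by
    intro A hA
    rw [Measure.map_apply hmeas hA, Set.preimage_smul_inv₀ ht.ne']
  have hz : μ.map (fun x : H => t⁻¹ • x) {0} = 0 := by
    rw [hmap _ (measurableSet_singleton 0)]
    simpa using h0
  ext A hA
  rw [← measure_sdiff_null hz, hmap _ (hA.diff (measurableSet_singleton 0)),
    hhom t ht _ (hA.diff (measurableSet_singleton 0)) (by simp), measure_sdiff_null h0]
  rfl

theorem tailIntegral_eq_rpow_mul {μ : Measure H} {α : ℝ} (h0 : μ {0} = 0)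
    (hhom : ∀ t : ℝ, 0 < t → ∀ A : Set H, MeasurableSet A → (0 : H) ∉ A →
      μ (t • A) = ENNReal.ofReal (t ^ (-α)) * μ A) (f : H →ᵇ ℝ) {t : ℝ} (ht : 0 < t) :
    tailIntegral μ f t = t ^ (-α) * tailIntegral μ f 1 := by
  have h := congrArg (fun m => tailIntegral m f 1) (map_inv_smul_eq_smul h0 hhom ht)
  simp only [tailIntegral] at h
  rw [setIntegral_map (f := fun x => f (angle x)) (measurableSet_lt_norm 1)
    (f.continuous.measurable.comp measurable_angle).aestronglyMeasurable
    (measurable_const_smul t⁻¹).aemeasurable, Measure.restrict_smul, integral_smul_measure,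
    ENNReal.toReal_ofReal (Real.rpow_nonneg ht.le _)] at h
  simp only [angle_smul (inv_pos.2 ht), smul_eq_mul] at h
  have hset : (fun x : H => t⁻¹ • x) ⁻¹' {x : H | 1 < ‖x‖} = {x : H | t < ‖x‖} := by
    ext x
    simp only [Set.mem_preimage, Set.mem_ofPred_eq, norm_smul, norm_inv, Real.norm_of_nonneg ht.le]
    rw [lt_inv_mul_iff₀ ht, mul_one]
  rwa [hset] at h

end TailIntegral

/-! ### From regular variation to the limit angular measure -/

section RegularVariation

variable {H : Type*} [NormedAddCommGroup H] [InnerProductSpace ℝ H] [MeasurableSpace H]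
  [BorelSpace H] [SecondCountableTopology H]

/-- The sharp threshold is squeezed between ramps just above and just below `r`; nothing is lost in
the limit because `s ^ (-α)` is continuous at `r`. The factor `max (b n) 0` is the real value of
`ENNReal.ofReal (b n)`. -/
theorem tendsto_mul_tailIntegral {ν μ : Measure H} [IsFiniteMeasure ν] {α : ℝ} {b : ℝ → ℝ}
    (hμ : MemMZero μ)
    (hconv : TendstoMZero
      (fun n : ℕ => ENNReal.ofReal (b n) • ν.map (fun x : H => (n : ℝ)⁻¹ • x)) μ)
    (hhom : ∀ t : ℝ, 0 < t → ∀ A : Set H, MeasurableSet A → (0 : H) ∉ A →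
      μ (t • A) = ENNReal.ofReal (t ^ (-α)) * μ A)
    {f : H →ᵇ ℝ} (hf : 0 ≤ f) {r : ℝ} (hr : 0 < r) :
    Tendsto (fun n : ℕ => max (b n) 0 * tailIntegral ν f (n * r)) atTop
      (𝓝 (r ^ (-α) * tailIntegral μ f 1)) := by
  have hJ : ∀ {r s : ℝ} (hr : 0 < r) (hrs : r < s), Tendsto
      (fun n : ℕ => max (b n) 0 * ∫ x, rampAngle f hr hrs ((n : ℝ)⁻¹ • x) ∂ν) atTop
      (𝓝 (∫ x, rampAngle f hr hrs x ∂μ)) := by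
    intro r s hr hrs
    refine (hconv _ (rampAngle_eventually_eq_zero f hr hrs)).congr fun n => ?_
    rw [integral_smul_measure, integral_map (measurable_const_smul _).aemeasurable
      (rampAngle f hr hrs).continuous.measurable.aestronglyMeasurable, ENNReal.toReal_ofReal',
      smul_eq_mul]
  have hμJ : ∀ {r s : ℝ} (hr : 0 < r) (hrs : r < s), ∫ x, rampAngle f hr hrs x ∂μ ∈
      Set.Icc (s ^ (-α) * tailIntegral μ f 1) (r ^ (-α) * tailIntegral μ f 1) := by
    intro r s hr hrs
    have h := integral_rampAngle_comp_smul_mem_Icc (m := μ) hf hr hrs one_pos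
      (by rw [one_mul]; exact hμ.measure_lt_norm_ne_top hr)
    simpa only [inv_one, one_smul, one_mul, tailIntegral_eq_rpow_mul hμ.1 hhom f hr,
      tailIntegral_eq_rpow_mul hμ.1 hhom f (hr.trans hrs)] using h
  have hcont : Tendsto (fun s : ℝ => s ^ (-α) * tailIntegral μ f 1) (𝓝 r)
      (𝓝 (r ^ (-α) * tailIntegral μ f 1)) :=
    (Real.continuousAt_rpow_const _ _ (Or.inl hr.ne')).tendsto.mul_const _
  rw [tendsto_order]
  constructor
  · intro a ha
    obtain ⟨s, has, hrs⟩ := (((hcont.eventually_const_lt ha).filter_mono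
      nhdsWithin_le_nhds).and (self_mem_nhdsWithin (s := Set.Ioi r))).exists
    filter_upwards [(hJ hr hrs).eventually_const_lt (has.trans_le (hμJ hr hrs).1),
      eventually_gt_atTop 0] with n hn hn0
    refine hn.trans_le (mul_le_mul_of_nonneg_left ?_ (le_max_right _ _))
    exact (integral_rampAngle_comp_smul_mem_Icc hf hr hrs (Nat.cast_pos.2 hn0)
      (measure_ne_top _ _)).2
  · intro a ha
    obtain ⟨s, ⟨has, hs⟩, hrs⟩ := ((((hcont.eventually_lt_const ha).and
      (eventually_gt_nhds hr)).filter_mono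
      nhdsWithin_le_nhds).and (self_mem_nhdsWithin (s := Set.Iio r))).exists
    filter_upwards [(hJ hs hrs).eventually_lt_const ((hμJ hs hrs).2.trans_lt has),
      eventually_gt_atTop 0] with n hn hn0
    refine (mul_le_mul_of_nonneg_left ?_ (le_max_right _ _)).trans_lt hn
    exact (integral_rampAngle_comp_smul_mem_Icc hf hs hrs (Nat.cast_pos.2 hn0)
      (measure_ne_top _ _)).1

/-- If the monotone functions `F` and `V` are, along the integers, asymptotic to multiples of the
same regularly varying function, then their ratio converges. -/
theorem tendsto_div_of_tendsto_mul {F V : ℝ → ℝ} {β : ℕ → ℝ} {G c α : ℝ} (hF : Antitone F)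
    (hV : Antitone V) (hF0 : ∀ t, 0 ≤ F t) (hV0 : ∀ t, 0 < V t) (hc : 0 < c)
    (hFlim : ∀ r : ℝ, 0 < r → Tendsto (fun n : ℕ => β n * F (n * r)) atTop (𝓝 (r ^ (-α) * G)))
    (hVlim : ∀ r : ℝ, 0 < r → Tendsto (fun n : ℕ => β n * V (n * r)) atTop (𝓝 (r ^ (-α) * c))) :
    Tendsto (fun t => F t / V t) atTop (𝓝 (G / c)) := by
  have hβ : ∀ᶠ n in atTop, β n ≠ 0 := by
    have h := hVlim 1 one_pos
    rw [Real.one_rpow, one_mul] at h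
    filter_upwards [h.eventually_const_lt hc] with n hn h0
    simp [h0] at hn
  have hratio : ∀ r s : ℝ, 0 < r → 0 < s → Tendsto (fun n : ℕ => F (n * r) / V (n * s)) atTop
      (𝓝 ((r ^ (-α) * G) / (s ^ (-α) * c))) := by
    intro r s hr hs
    refine ((hFlim r hr).div (hVlim s hs)
      (mul_pos (Real.rpow_pos_of_pos hs _) hc).ne').congr' ?_
    filter_upwards [hβ] with n hn
    exact mul_div_mul_left _ _ hn
  have hpow : Tendsto (fun s : ℝ => s ^ (-α)) (𝓝 1) (𝓝 1) := by
    simpa using (Real.continuousAt_rpow_const 1 (-α) (Or.inl one_ne_zero)).tendsto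
  have hfloor : Tendsto (fun t : ℝ => ⌊t⌋₊) atTop atTop := tendsto_nat_floor_atTop
  -- Once `⌊t⌋₊ ≥ 1 / (s - 1)`, also `t ≤ ⌊t⌋₊ + 1 ≤ ⌊t⌋₊ * s`, so monotonicity passes from integers
  -- to real `t` at the cost of a factor `s` close to `1`.
  have hle : ∀ s : ℝ, 1 < s → ∀ᶠ t : ℝ in atTop, (⌊t⌋₊ : ℝ) ≤ t ∧ t ≤ ⌊t⌋₊ * s := by
    intro s hs
    filter_upwards [hfloor.eventually_ge_atTop ⌈(s - 1)⁻¹⌉₊, eventually_ge_atTop 0] with t ht ht0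
    refine ⟨Nat.floor_le ht0, (Nat.lt_floor_add_one t).le.trans ?_⟩
    have h1 : (s - 1)⁻¹ ≤ (⌊t⌋₊ : ℝ) := (Nat.le_ceil _).trans (Nat.cast_le.2 ht)
    rw [inv_le_iff_one_le_mul₀ (by linarith)] at h1
    linarith
  rw [tendsto_order]
  constructor
  · intro a ha
    have h1 : Tendsto (fun s : ℝ => (s ^ (-α) * G) / ((1 : ℝ) ^ (-α) * c)) (𝓝 1) (𝓝 (G / c)) := by
      simpa using (hpow.mul_const G).div_const c
    obtain ⟨s, has, hs⟩ := (((h1.eventually_const_lt ha).filter_mono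
      nhdsWithin_le_nhds).and (self_mem_nhdsWithin (s := Set.Ioi 1))).exists
    filter_upwards [hle s hs, hfloor.eventually
      ((hratio s 1 (one_pos.trans hs) one_pos).eventually_const_lt has)] with t ht hlt
    rw [mul_one] at hlt
    exact hlt.trans_le (div_le_div₀ (hF0 _) (hF ht.2) (hV0 _) (hV ht.1))
  · intro a ha
    have h1 : Tendsto (fun s : ℝ => ((1 : ℝ) ^ (-α) * G) / (s ^ (-α) * c)) (𝓝 1) (𝓝 (G / c)) := by
      simp only [Real.one_rpow, one_mul]
      have h2 := (tendsto_const_nhds (x := G)).div (hpow.mul_const c) (by simpa using hc.ne')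
      rwa [one_mul] at h2
    obtain ⟨s, has, hs⟩ := (((h1.eventually_lt_const ha).filter_mono
      nhdsWithin_le_nhds).and (self_mem_nhdsWithin (s := Set.Ioi 1))).exists
    filter_upwards [hle s hs, hfloor.eventually
      ((hratio 1 s one_pos (one_pos.trans hs)).eventually_lt_const has)] with t ht hlt
    rw [mul_one] at hlt
    exact (div_le_div₀ (hF0 _) (hF ht.1) (hV0 _) (hV ht.2)).trans_lt hlt

/-- For `s > 1` and `n` large, `n + 1 ≤ n * s`, so the ratio is at least `V (n * s) / V n`, which
tends to `s ^ (-α)`; then `s` is taken close to `1`. -/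
theorem tendsto_succ_div_of_tendsto_mul {V : ℝ → ℝ} {β : ℕ → ℝ} {c α : ℝ}
    (hV : Antitone V) (hV0 : ∀ t, 0 < V t) (hc : 0 < c)
    (hVlim : ∀ r : ℝ, 0 < r → Tendsto (fun n : ℕ => β n * V (n * r)) atTop (𝓝 (r ^ (-α) * c))) :
    Tendsto (fun n : ℕ => V (n + 1) / V n) atTop (𝓝 1) := by
  have h1 := hVlim 1 one_pos
  rw [Real.one_rpow, one_mul] at h1
  have hpow : Tendsto (fun s : ℝ => s ^ (-α)) (𝓝 1) (𝓝 1) := by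
    simpa using (Real.continuousAt_rpow_const 1 (-α) (Or.inl one_ne_zero)).tendsto
  rw [tendsto_order]
  constructor
  · intro a ha
    obtain ⟨s, has, hs⟩ := (((hpow.eventually_const_lt ha).filter_mono
      nhdsWithin_le_nhds).and (self_mem_nhdsWithin (s := Set.Ioi 1))).exists
    have hs : 1 < s := hs
    have h2 := (hVlim s (one_pos.trans hs)).div h1 hc.ne'
    rw [mul_div_cancel_right₀ _ hc.ne'] at h2
    filter_upwards [h2.eventually_const_lt has, h1.eventually_const_lt hc,
      eventually_ge_atTop ⌈(s - 1)⁻¹⌉₊] with n hn hpos hle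
    have hβ : β n ≠ 0 := by
      rintro h0
      simp [h0] at hpos
    simp only [Pi.div_apply, mul_one] at hn
    rw [mul_div_mul_left _ _ hβ] at hn
    refine hn.trans_le (div_le_div_of_nonneg_right (hV ?_) (hV0 _).le)
    have h3 : (s - 1)⁻¹ ≤ (n : ℝ) := (Nat.le_ceil _).trans (Nat.cast_le.2 hle)
    rw [inv_le_iff_one_le_mul₀ (by linarith)] at h3
    linarith
  · intro a ha
    refine Eventually.of_forall fun n => (div_le_one_of_le₀ (hV ?_) (hV0 _).le).trans_lt ha
    linarith

theorem bcf_zero_le_one {E : Type*} [TopologicalSpace E] :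
    (0 : E →ᵇ ℝ) ≤ 1 :=
  fun _ => zero_le_one

/-- If the mass beyond radius `1` vanished, homogeneity would make it vanish beyond every positive
radius. -/
theorem tailIntegral_one_pos {μ : Measure H} {α : ℝ} (hμ : MemMZero μ) (hμ0 : μ ≠ 0)
    (hhom : ∀ t : ℝ, 0 < t → ∀ A : Set H, MeasurableSet A → (0 : H) ∉ A →
      μ (t • A) = ENNReal.ofReal (t ^ (-α)) * μ A) : 0 < tailIntegral μ (1 : H →ᵇ ℝ) 1 := by
  refine (tailIntegral_nonneg μ bcf_zero_le_one 1).lt_of_ne' fun h => hμ0 ?_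
  have hnull : ∀ n : ℕ, μ {x : H | 1 / ((n : ℝ) + 1) < ‖x‖} = 0 := by
    intro n
    have hn : (0 : ℝ) < 1 / ((n : ℝ) + 1) := Nat.one_div_pos_of_nat
    have h1 := tailIntegral_eq_rpow_mul hμ.1 hhom 1 hn
    rw [h, mul_zero, tailIntegral_one] at h1
    exact (measureReal_eq_zero_iff (hμ.measure_lt_norm_ne_top hn)).1 h1
  rw [← Measure.measure_univ_eq_zero]
  refine measure_mono_null (t := {0} ∪ ⋃ n : ℕ, {x : H | 1 / ((n : ℝ) + 1) < ‖x‖}) ?_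
    (measure_union_null hμ.1 (measure_iUnion_null hnull))
  intro x _
  by_cases hx : x = 0
  · exact Or.inl hx
  · obtain ⟨n, hn⟩ := exists_nat_one_div_lt (norm_pos_iff.2 hx)
    exact Or.inr (Set.mem_iUnion.2 ⟨n, hn⟩)

theorem integral_angularLaw (m : Measure H) (f : H →ᵇ ℝ) (t : ℝ) :
    ∫ x, f x ∂(angularLaw m t) = tailIntegral m f t / tailIntegral m 1 t := by
  rw [angularLaw, integral_map measurable_angle.aemeasurable
    f.continuous.measurable.aestronglyMeasurable, ProbabilityTheory.cond, integral_smul_measure,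
    tailIntegral_one, ENNReal.toReal_inv, smul_eq_mul, inv_mul_eq_div]
  rfl

theorem isProbabilityMeasure_angularLaw {m : Measure H} {t : ℝ}
    (h : m {x : H | t < ‖x‖} ≠ ∞) (h0 : m {x : H | t < ‖x‖} ≠ 0) :
    IsProbabilityMeasure (angularLaw m t) := by
  have := cond_isProbabilityMeasure_of_finite h0 h
  exact Measure.isProbabilityMeasure_map measurable_angle.aemeasurable

theorem angularLaw_compl_sphere (m : Measure H) {t : ℝ} (ht : 0 ≤ t) :
    angularLaw m t (Metric.sphere (0 : H) 1)ᶜ = 0 := by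
  rw [angularLaw, Measure.map_apply measurable_angle Metric.isClosed_sphere.measurableSet.compl,
    cond_apply (measurableSet_lt_norm t)]
  have : {x : H | t < ‖x‖} ∩ angle ⁻¹' (Metric.sphere (0 : H) 1)ᶜ = ∅ := by
    rw [Set.eq_empty_iff_forall_notMem]
    rintro x ⟨hx, hx'⟩
    refine hx' ?_
    rw [mem_sphere_zero_iff_norm]
    exact norm_angle_of_ne_zero (norm_pos_iff.1 (ht.trans_lt hx))
  rw [this, measure_empty, mul_zero]

theorem antitone_tailIntegral (ν : Measure H) [IsFiniteMeasure ν] {f : H →ᵇ ℝ} (hf : 0 ≤ f) :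
    Antitone (tailIntegral ν f) :=
  fun _ _ h => tailIntegral_anti hf (measure_ne_top _ _) h

/-- A regularly varying distribution has a limit angular measure, and the tail function of the norm
is positive and long-tailed. -/
theorem IsRegularlyVarying.exists_isLimitAngularMeasure {ν : Measure H} [IsProbabilityMeasure ν]
    {α : ℝ} (hν : IsRegularlyVarying ν α) :
    (∃ Q, IsLimitAngularMeasure ν Q) ∧ (∀ t, 0 < ν.real {x : H | t < ‖x‖}) ∧
      Tendsto (fun n : ℕ => ν.real {x : H | (n : ℝ) + 1 < ‖x‖} / ν.real {x : H | (n : ℝ) < ‖x‖})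
        atTop (𝓝 1) := by
  obtain ⟨μ, b, -, hμ, hμ0, -, hconv, hhom⟩ := hν
  have hc := tailIntegral_one_pos hμ hμ0 hhom
  have hlim := fun (f : H →ᵇ ℝ) (hf : 0 ≤ f) (r : ℝ) (hr : 0 < r) =>
    tendsto_mul_tailIntegral hμ hconv hhom hf hr
  have hVpos : ∀ t, 0 < tailIntegral ν (1 : H →ᵇ ℝ) t := by
    intro t
    have h := hlim 1 bcf_zero_le_one 1 one_pos
    rw [Real.one_rpow, one_mul] at h
    obtain ⟨n, hn, htn⟩ := ((h.eventually_const_lt hc).and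
      (eventually_ge_atTop ⌈t⌉₊)).exists
    have h1 : 0 < tailIntegral ν (1 : H →ᵇ ℝ) (n * 1) := by
      refine (tailIntegral_nonneg _ bcf_zero_le_one _).lt_of_ne' fun h0 => ?_
      simp only [h0, mul_zero, lt_irrefl] at hn
    refine h1.trans_le (antitone_tailIntegral ν bcf_zero_le_one ?_)
    rw [mul_one]
    exact (Nat.le_ceil t).trans (Nat.cast_le.2 htn)
  have hrat : ∀ f : H →ᵇ ℝ, 0 ≤ f → Tendsto (fun t => tailIntegral ν f t / tailIntegral ν 1 t)
      atTop (𝓝 (tailIntegral μ f 1 / tailIntegral μ 1 1)) := fun f hf =>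
    tendsto_div_of_tendsto_mul (antitone_tailIntegral ν hf)
      (antitone_tailIntegral ν bcf_zero_le_one)
      (tailIntegral_nonneg ν hf) hVpos hc (hlim f hf) (hlim 1 bcf_zero_le_one)
  have hQ : IsProbabilityMeasure (angularLaw μ 1) := by
    refine isProbabilityMeasure_angularLaw (hμ.measure_lt_norm_ne_top one_pos) fun h => ?_
    rw [tailIntegral_one, measureReal_def, h] at hc
    simp at hc
  refine ⟨⟨angularLaw μ 1, hQ, angularLaw_compl_sphere μ zero_le_one, fun f => ?_⟩, ?_, ?_⟩
  · have hprob : ∀ t, IsProbabilityMeasure (angularLaw ν t) := by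
      refine fun t => isProbabilityMeasure_angularLaw (measure_ne_top _ _) fun h => ?_
      have := hVpos t
      rw [tailIntegral_one, measureReal_def, h] at this
      simp at this
    -- The ratio limit needs `f ≥ 0`; adding the constant `‖f‖` shifts all integrals against
    -- probability measures equally.
    have hshift : ∀ (m : Measure H) [IsProbabilityMeasure m],
        ∫ x, f x ∂m = ∫ x, (f + BoundedContinuousFunction.const H ‖f‖) x ∂m - ‖f‖ := by
      intro m _
      simp only [BoundedContinuousFunction.coe_add, Pi.add_apply,
        BoundedContinuousFunction.const_apply]
      rw [integral_add (f.integrable m) (integrable_const _)]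
      simp
    have hf : 0 ≤ f + BoundedContinuousFunction.const H ‖f‖ := by
      intro x
      have := neg_le_of_abs_le (f.norm_coe_le_norm x)
      change 0 ≤ f x + ‖f‖
      linarith
    have h := (hrat _ hf).sub_const ‖f‖
    rw [← integral_angularLaw, ← hshift] at h
    refine h.congr fun t => ?_
    rw [← integral_angularLaw, ← hshift]
  · intro t
    rw [← tailIntegral_one]
    exact hVpos t
  · simpa only [tailIntegral_one] using tendsto_succ_div_of_tendsto_mul
      (antitone_tailIntegral ν bcf_zero_le_one) hVpos hc (hlim 1 bcf_zero_le_one)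

end RegularVariation

/-! ### Deterministic thresholds -/

section Threshold

/-- For a positive long-tailed decreasing sequence, every level that tends to `0` is asymptotic to
values of the sequence. -/
theorem exists_tendsto_div_of_long_tailed {V p : ℕ → ℝ} (hV : Antitone V) (hV0 : ∀ m, 0 < V m)
    (hVlim : Tendsto V atTop (𝓝 0)) (hVr : Tendsto (fun m => V (m + 1) / V m) atTop (𝓝 1))
    (hp0 : ∀ᶠ j in atTop, 0 < p j) (hp : Tendsto p atTop (𝓝 0)) :
    ∃ u : ℕ → ℕ, Tendsto u atTop atTop ∧ Tendsto (fun j => V (u j) / p j) atTop (𝓝 1) := by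
  -- The level `u` is the first integer with `V u ≤ p`. Then `p < V (u - 1)`, so `V u / p` lies
  -- between `V u / V (u - 1)` and `1`.
  have hmem : ∀ᶠ j in atTop, V (sInf {m | V m ≤ p j}) ≤ p j := by
    filter_upwards [hp0] with j hj
    obtain ⟨m, hm⟩ := (hVlim.eventually_le_const hj).exists
    exact Nat.sInf_mem (s := {m | V m ≤ p j}) ⟨m, hm⟩
  have hu : Tendsto (fun j => sInf {m | V m ≤ p j}) atTop atTop := by
    rw [tendsto_atTop]
    intro M
    filter_upwards [hmem, hp.eventually_lt_const (hV0 M)] with j hj hlt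
    by_contra! h
    exact absurd (hV h.le) (not_le.2 (hj.trans_lt hlt))
  refine ⟨_, hu, ?_⟩
  have hlow := hVr.comp ((tendsto_sub_atTop_nat 1).comp hu)
  refine tendsto_of_tendsto_of_tendsto_of_le_of_le' hlow tendsto_const_nhds ?_ ?_
  · filter_upwards [hu.eventually_gt_atTop 0, hp0] with j hj hpj
    simp only [Function.comp_apply]
    rw [Nat.sub_add_cancel hj]
    have h := Nat.notMem_of_lt_sInf (Nat.sub_lt hj one_pos)
    exact div_le_div_of_nonneg_left (hV0 _).le hpj (not_le.1 h).le
  · filter_upwards [hmem, hp0] with j hj hpj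
    exact div_le_one_of_le₀ hj hpj.le

end Threshold

/-! ### Largest points versus exceedances -/

section OrderStatistics

variable {H : Type*} [NormedAddCommGroup H]

/-- The sum of a function bounded by `1` over the `k` largest sample points differs from the sum
over the points of norm larger than `u` by at most the difference of the numbers of terms. -/
theorem abs_sum_top_sub_sum_exceed_le [InnerProductSpace ℝ H] {n : ℕ} {x : Fin n → H}
    {σ : Equiv.Perm (Fin n)} (hσ : OrdersByNorm x σ) {k : ℕ} (hk : k ≤ n) {g : H → ℝ}
    (hg : ∀ x, |g x| ≤ 1) (u : ℝ) :
    |∑ i ∈ Finset.univ.filter (fun i : Fin n => i.val < k), g (x (σ i)) -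
        ∑ i, {x : H | u < ‖x‖}.indicator g (x i)| ≤
      |∑ i, {x : H | u < ‖x‖}.indicator (fun _ => (1 : ℝ)) (x i) - k| := by
  classical
  have hcard : (k : ℝ) = ∑ i : Fin n, if i.val < k then (1 : ℝ) else 0 := by
    rw [← Finset.sum_filter, Finset.sum_const, nsmul_eq_mul, mul_one, Fin.card_filter_val_lt,
      min_eq_right hk]
  rw [← Equiv.sum_comp σ fun i => {x : H | u < ‖x‖}.indicator g (x i),
    ← Equiv.sum_comp σ fun i => {x : H | u < ‖x‖}.indicator (fun _ => (1 : ℝ)) (x i),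
    Finset.sum_filter, hcard, ← Finset.sum_sub_distrib, ← Finset.sum_sub_distrib]
  simp only [Set.indicator_apply, Set.mem_ofPred_eq]
  -- One index set contains the other, so the count differences all have the same sign and their
  -- absolute values add up to the right-hand side.
  have hcases : (∀ i : Fin n, i.val < k → u < ‖x (σ i)‖) ∨
      (∀ i : Fin n, u < ‖x (σ i)‖ → i.val < k) := by
    by_contra! h
    obtain ⟨⟨i, hi, hui⟩, j, huj, hj⟩ := h
    have hij : i ≤ j := Fin.le_def.2 (hi.le.trans hj)
    exact absurd (huj.trans_le (hσ hij)) (not_lt.2 hui)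
  refine (Finset.abs_sum_le_sum_abs _ _).trans ?_
  rcases hcases with h | h
  · refine le_trans (Finset.sum_le_sum fun i _ => ?_) (le_abs_self _)
    by_cases hu : u < ‖x (σ i)‖
    · by_cases hi : i.val < k
      · simp [hu, hi]
      · simpa [hu, hi] using hg (x (σ i))
    · simp [hu, mt (h i) hu]
  · refine le_trans ?_ (neg_le_abs _)
    rw [← Finset.sum_neg_distrib]
    refine Finset.sum_le_sum fun i _ => ?_
    by_cases hi : i.val < k
    · by_cases hu : u < ‖x (σ i)‖
      · simp [hu, hi]
      · simpa [hu, hi] using hg (x (σ i))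
    · simp [hi, mt (h i) hi]

end OrderStatistics

/-! ### Chebyshev bound for sums of independent terms -/

section Chebyshev

/-- The second moment is kept in the bound, rather than estimated by `1`: for `h` supported on a
rare event it is of the order of that event's probability. -/
theorem measure_le_abs_sum_sub_le {E Ω : Type*} [MeasurableSpace E] [MeasurableSpace Ω]
    {P : Measure Ω} [IsProbabilityMeasure P] {ν : Measure E} {X : ℕ → Ω → E}
    (hlaw : ∀ i, HasLaw (X i) ν P) (hindep : iIndepFun X P) {h : E → ℝ} (hm : Measurable h)
    (hb : ∀ x, |h x| ≤ 1) (n : ℕ) {c : ℝ} (hc : 0 < c) :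
    P {ω | c ≤ |∑ i : Fin n, h (X i ω) - n * ∫ x, h x ∂ν|} ≤
      ENNReal.ofReal (n * (∫ x, h x ^ 2 ∂ν) / c ^ 2) := by
  have hmeas : ∀ i, AEStronglyMeasurable (fun ω => h (X i ω)) P := fun i =>
    (hm.comp_aemeasurable (hlaw i).aemeasurable).aestronglyMeasurable
  have hLp : ∀ i, MemLp (fun ω => h (X i ω)) 2 P := fun i =>
    MemLp.of_bound (hmeas i) 1 (ae_of_all _ fun ω => hb _)
  have hsum : MemLp (∑ i ∈ Finset.range n, fun ω => h (X i ω)) 2 P :=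
    memLp_finsetSum' _ fun i _ => hLp i
  have hmean : ∫ ω, (∑ i ∈ Finset.range n, fun ω => h (X i ω)) ω ∂P = n * ∫ x, h x ∂ν := by
    simp only [Finset.sum_apply]
    rw [integral_finsetSum _ fun i _ => (hLp i).integrable one_le_two]
    have h1 : ∀ i, ∫ ω, h (X i ω) ∂P = ∫ x, h x ∂ν := fun i =>
      (hlaw i).integral_comp hm.aestronglyMeasurable
    simp [h1]
  have hvar : variance (∑ i ∈ Finset.range n, fun ω => h (X i ω)) P ≤ n * ∫ x, h x ^ 2 ∂ν := by
    rw [IndepFun.variance_sum (fun i _ => hLp i)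
      fun i _ j _ hij => (hindep.indepFun hij).comp hm hm]
    have h1 : ∀ i, variance (fun ω => h (X i ω)) P ≤ ∫ x, h x ^ 2 ∂ν := by
      refine fun i => (variance_le_expectation_sq (hmeas i)).trans_eq ?_
      simp only [Pi.pow_apply]
      exact (hlaw i).integral_comp (f := fun x => h x ^ 2) (hm.pow_const 2).aestronglyMeasurable
    refine (Finset.sum_le_sum fun i _ => h1 i).trans_eq ?_
    simp
  refine le_trans (measure_mono fun ω hω => ?_) ((meas_ge_le_variance_div_sq hsum hc).trans
    (ENNReal.ofReal_le_ofReal (div_le_div_of_nonneg_right hvar (sq_nonneg c))))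
  rw [Set.mem_ofPred_eq, hmean, Finset.sum_apply, ← Fin.sum_univ_eq_sum_range fun i => h (X i ω)]
  exact hω

end Chebyshev

/-! ### Weak consistency of the empirical angular law -/

section WeakConsistency

variable {H : Type*} [NormedAddCommGroup H] [InnerProductSpace ℝ H] [MeasurableSpace H]
  [BorelSpace H] [SecondCountableTopology H] {Ω : Type*} [MeasurableSpace Ω] {P : Measure Ω}
  [IsProbabilityMeasure P] {ν Q : Measure H} {X : ℕ → Ω → H}

/-- The normalised mean is `(n V(u) / k)` times the angular integral beyond `u`, hence converges.
The Chebyshev bound is `(n V(u) / k) / (k (ε/2)²)`, which vanishes because `k → ∞`. -/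
theorem tendsto_measure_exceed_sum_sub [IsFiniteMeasure ν] (hlaw : ∀ i, HasLaw (X i) ν P)
    (hindep : iIndepFun X P)
    (hQ : IsLimitAngularMeasure ν Q) (hV0 : ∀ t, 0 < ν.real {x : H | t < ‖x‖}) {f : H →ᵇ ℝ}
    (hf : ∀ x, |f x| ≤ 1) {n k : ℕ → ℕ} {u : ℕ → ℝ} (hk : Tendsto k atTop atTop)
    (hu : Tendsto u atTop atTop)
    (hnk : Tendsto (fun j => n j * ν.real {x : H | u j < ‖x‖} / k j) atTop (𝓝 1)) {ε : ℝ}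
    (hε : 0 < ε) :
    Tendsto (fun j => P {ω | ε ≤ |(k j : ℝ)⁻¹ *
      ∑ i : Fin (n j), {x : H | u j < ‖x‖}.indicator (fun x => f (angle x)) (X i ω) -
        ∫ x, f x ∂Q|}) atTop (𝓝 0) := by
  have hmean : Tendsto (fun j => (k j : ℝ)⁻¹ * (n j * tailIntegral ν f (u j))) atTop
      (𝓝 (∫ x, f x ∂Q)) := by
    have h := hnk.mul ((hQ.2.2 f).comp hu)
    rw [one_mul] at h
    refine h.congr fun j => ?_
    have := (hV0 (u j)).ne'
    rw [Function.comp_apply, integral_angularLaw, tailIntegral_one]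
    field_simp
  have hbound : Tendsto (fun j => ENNReal.ofReal
      ((n j * ν.real {x : H | u j < ‖x‖} / k j) * ((ε / 2) ^ 2)⁻¹ * (k j : ℝ)⁻¹)) atTop (𝓝 0) := by
    have h := (hnk.mul_const (((ε / 2) ^ 2)⁻¹)).mul
      ((tendsto_inv_atTop_nhds_zero_nat (𝕜 := ℝ)).comp hk)
    rw [mul_zero] at h
    simpa using ENNReal.tendsto_ofReal h
  refine tendsto_of_tendsto_of_tendsto_of_le_of_le' tendsto_const_nhds hbound
    (Eventually.of_forall fun _ => zero_le) ?_
  filter_upwards [hk.eventually_gt_atTop 0, Metric.tendsto_nhds.1 hmean (ε / 2) (by linarith)]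
    with j hkj hj
  have hk0 : (0 : ℝ) < k j := Nat.cast_pos.2 hkj
  have hm : Measurable ({x : H | u j < ‖x‖}.indicator fun x => f (angle x)) :=
    (f.continuous.measurable.comp measurable_angle).indicator (measurableSet_lt_norm _)
  have hb : ∀ x, |{x : H | u j < ‖x‖}.indicator (fun x => f (angle x)) x| ≤ 1 := by
    intro x
    rw [Set.indicator_apply]
    split_ifs
    · exact hf _
    · simp
  have hsq : ∫ x, {x : H | u j < ‖x‖}.indicator (fun x => f (angle x)) x ^ 2 ∂ν ≤
      ν.real {x : H | u j < ‖x‖} := by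
    rw [← tailIntegral_one, tailIntegral_eq_integral_indicator]
    refine integral_mono_of_nonneg (ae_of_all _ fun x => sq_nonneg _)
      ((integrable_indicator_iff (measurableSet_lt_norm _)).2
        (integrableOn_comp_angle _ (measure_ne_top _ _))) (ae_of_all _ fun x => ?_)
    simp only [Set.indicator_apply]
    split_ifs
    · exact (sq_le_one_iff_abs_le_one _).2 (hf _)
    · simp
  refine le_trans (measure_mono fun ω hω => ?_) ((measure_le_abs_sum_sub_le hlaw hindep hm hb (n j)
    (c := k j * (ε / 2)) (by positivity)).trans (ENNReal.ofReal_le_ofReal ?_))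
  · rw [Set.mem_ofPred_eq] at hω ⊢
    rw [Real.dist_eq] at hj
    rw [← tailIntegral_eq_integral_indicator]
    set S := ∑ i : Fin (n j), {x : H | u j < ‖x‖}.indicator (fun x => f (angle x)) (X i ω)
    have h1 := abs_sub_le ((k j : ℝ)⁻¹ * S) ((k j : ℝ)⁻¹ * (n j * tailIntegral ν f (u j)))
      (∫ x, f x ∂Q)
    rw [← mul_sub, abs_mul, abs_of_pos (inv_pos.2 hk0)] at h1
    rw [← le_inv_mul_iff₀ hk0]
    linarith
  · calc _ ≤ n j * ν.real {x : H | u j < ‖x‖} / (k j * (ε / 2)) ^ 2 := by gcongr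
      _ = _ := by field_simp

/-- The empirical distribution of the angles of the `k` largest sample points converges weakly in
probability to the limit angular measure. -/
theorem tendsto_measure_mean_top_angle_sub [IsProbabilityMeasure ν]
    (hlaw : ∀ i, HasLaw (X i) ν P) (hindep : iIndepFun X P)
    (hQ : IsLimitAngularMeasure ν Q) (hV0 : ∀ t, 0 < ν.real {x : H | t < ‖x‖})
    (hVr : Tendsto
      (fun n : ℕ => ν.real {x : H | (n : ℝ) + 1 < ‖x‖} / ν.real {x : H | (n : ℝ) < ‖x‖})
      atTop (𝓝 1)) {σ : (n : ℕ) → Ω → Equiv.Perm (Fin n)}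
    (hσ : ∀ n ω, OrdersByNorm (fun i : Fin n => X i ω) (σ n ω)) {f : H →ᵇ ℝ}
    (hf : ∀ x, |f x| ≤ 1) {n k : ℕ → ℕ} (hn : Tendsto n atTop atTop) (hk : Tendsto k atTop atTop)
    (hkn : Tendsto (fun j => (k j : ℝ) / (n j : ℝ)) atTop (𝓝 0)) {ε : ℝ} (hε : 0 < ε) :
    Tendsto (fun j => P {ω | ε ≤ |(k j : ℝ)⁻¹ *
      ∑ i ∈ Finset.univ.filter (fun i : Fin (n j) => i.val < k j),
        f (angle (X (σ (n j) ω i) ω)) - ∫ x, f x ∂Q|}) atTop (𝓝 0) := by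
  have hQ1 := hQ.1
  have hVlim : Tendsto (fun m : ℕ => ν.real {x : H | (m : ℝ) < ‖x‖}) atTop (𝓝 0) := by
    have h := tendsto_measure_iInter_atTop (μ := ν) (s := fun m : ℕ => {x : H | (m : ℝ) < ‖x‖})
      (fun m => (measurableSet_lt_norm _).nullMeasurableSet)
      (fun a b hab x (hx : (b : ℝ) < ‖x‖) => (Nat.cast_le.2 hab).trans_lt hx)
      ⟨0, measure_ne_top _ _⟩
    have hempty : ⋂ m : ℕ, {x : H | (m : ℝ) < ‖x‖} = ∅ := by
      rw [Set.eq_empty_iff_forall_notMem]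
      intro x hx
      obtain ⟨m, hm⟩ := exists_nat_gt ‖x‖
      exact lt_asymm hm (Set.mem_iInter.1 hx m)
    rw [hempty, measure_empty] at h
    exact (ENNReal.tendsto_toReal ENNReal.zero_ne_top).comp h
  have hkn0 : ∀ᶠ j in atTop, 0 < (k j : ℝ) / n j := by
    filter_upwards [hn.eventually_gt_atTop 0, hk.eventually_gt_atTop 0] with j hnj hkj
    exact div_pos (Nat.cast_pos.2 hkj) (Nat.cast_pos.2 hnj)
  obtain ⟨u, hu, hlim⟩ := exists_tendsto_div_of_long_tailed
    (V := fun m : ℕ => ν.real {x : H | (m : ℝ) < ‖x‖})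
    (fun a b hab => measureReal_mono fun x (hx : (b : ℝ) < ‖x‖) => (Nat.cast_le.2 hab).trans_lt hx)
    (fun m => hV0 m) hVlim (by simpa using hVr) hkn0 hkn
  have hnk : Tendsto (fun j => n j * ν.real {x : H | ((u j : ℕ) : ℝ) < ‖x‖} / k j) atTop (𝓝 1) :=
    hlim.congr fun j => by rw [div_div_eq_mul_div, mul_comm]
  have hu' : Tendsto (fun j => ((u j : ℕ) : ℝ)) atTop atTop := tendsto_natCast_atTop_atTop.comp hu
  have h1 := tendsto_measure_exceed_sum_sub hlaw hindep hQ hV0 hf hk hu' hnk (half_pos hε)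
  -- The constant function `1` controls the number of exceedances.
  have h2 := tendsto_measure_exceed_sum_sub hlaw hindep hQ hV0 (f := 1) (by simp) hk hu' hnk
    (half_pos hε)
  have h3 := h1.add h2
  rw [add_zero] at h3
  refine tendsto_of_tendsto_of_tendsto_of_le_of_le' tendsto_const_nhds h3
    (Eventually.of_forall fun _ => zero_le) ?_
  filter_upwards [hk.eventually_gt_atTop 0, hn.eventually_gt_atTop 0,
    hkn.eventually_lt_const one_pos] with j hkj hnj hlt
  have hk0 : (0 : ℝ) < k j := Nat.cast_pos.2 hkj
  have hle : k j ≤ n j := by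
    rw [div_lt_one (Nat.cast_pos.2 hnj)] at hlt
    exact (Nat.cast_lt.1 hlt).le
  -- The ordering `σ` need not be measurable in `ω`; inclusion of events and subadditivity suffice.
  refine (measure_mono fun ω hω => ?_).trans (measure_union_le _ _)
  rw [Set.mem_union, Set.mem_ofPred_eq, Set.mem_ofPred_eq]
  rw [Set.mem_ofPred_eq] at hω
  by_contra! h
  have htop := abs_sum_top_sub_sum_exceed_le (hσ (n j) ω) hle (g := fun x => f (angle x))
    (fun x => hf _) (u j)
  simp only [BoundedContinuousFunction.coe_one, Pi.one_apply, integral_const, probReal_univ,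
    one_smul] at h
  set T := ∑ i ∈ Finset.univ.filter (fun i : Fin (n j) => i.val < k j),
    f (angle (X (σ (n j) ω i) ω))
  set S := ∑ i : Fin (n j), {x : H | (u j : ℝ) < ‖x‖}.indicator (fun x => f (angle x)) (X i ω)
  set N := ∑ i : Fin (n j), {x : H | (u j : ℝ) < ‖x‖}.indicator (fun _ => (1 : ℝ)) (X i ω)
  have hN : |(k j : ℝ)⁻¹ * T - (k j : ℝ)⁻¹ * S| ≤ |(k j : ℝ)⁻¹ * N - 1| := by
    rw [← mul_sub, ← inv_mul_cancel₀ hk0.ne', ← mul_sub, abs_mul, abs_mul]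
    exact mul_le_mul_of_nonneg_left htop (abs_nonneg _)
  have := abs_sub_le ((k j : ℝ)⁻¹ * T) ((k j : ℝ)⁻¹ * S) (∫ x, f x ∂Q)
  linarith [h.1, h.2]

end WeakConsistency

/-! ### Hilbert–Schmidt distance from finitely many entries -/

section HilbertSchmidt

variable {H : Type*} [NormedAddCommGroup H] [InnerProductSpace ℝ H]

/-- Orthonormal vectors are at distance `√2`, so balls of radius `1/2` around them are disjoint.
Countability permits termwise integration of the trace. -/
theorem Orthonormal.countable_index {E ι : Type*} [NormedAddCommGroup E] [InnerProductSpace ℝ E]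
    [SecondCountableTopology E] {v : ι → E} (hv : Orthonormal ℝ v) : Countable ι := by
  have hdisj : Pairwise (Function.onFun Disjoint fun i => Metric.ball (v i) (1 / 2)) := by
    intro i j hij
    refine Metric.ball_disjoint_ball ?_
    have h : ‖v i - v j‖ ^ 2 = 2 := by
      rw [@norm_sub_sq_real, hv.1 i, hv.1 j, hv.2 hij]
      norm_num
    rw [dist_eq_norm]
    nlinarith [norm_nonneg (v i - v j)]
  exact hdisj.countable_of_isOpen_disjoint (fun _ => Metric.isOpen_ball)
    fun i => ⟨v i, Metric.mem_ball_self (by norm_num)⟩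

/-- The properties of `E[Θ ⊗ Θ]`, for `‖Θ‖ ≤ 1`, that are preserved by averages: it is symmetric,
positive, contractive, and its trace is at most `1`. -/
structure IsSubunitCov {ι : Type*} (e : HilbertBasis ι ℝ H) (A : H →L[ℝ] H) : Prop where
  symm : ∀ x y, inner ℝ (A x) y = inner ℝ (A y) x
  nonneg : ∀ x, 0 ≤ inner ℝ (A x) x
  le : ∀ x, inner ℝ (A x) x ≤ ‖x‖ ^ 2
  trace_le : ∀ F : Finset ι, ∑ i ∈ F, inner ℝ (A (e i)) (e i) ≤ 1

variable {ι : Type*} {e : HilbertBasis ι ℝ H} {A B : H →L[ℝ] H}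

/-- Positivity at `x - A x` reads `⟪Ax, x⟫ - 2‖Ax‖² + ⟪A(Ax), Ax⟫ ≥ 0`, and the last term is at most
`‖Ax‖²`. -/
theorem IsSubunitCov.norm_sq_le (hA : IsSubunitCov e A) (x : H) : ‖A x‖ ^ 2 ≤ inner ℝ (A x) x := by
  have h1 := hA.nonneg (x - A x)
  have h2 := hA.le (A x)
  rw [map_sub, inner_sub_left, inner_sub_right, inner_sub_right, hA.symm (A x) x,
    real_inner_self_eq_norm_sq] at h1
  linarith

/-- Off `F`, squared columns are at most twice the sum of the diagonal entries of `A` and `B`. Each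
off-`F` trace is at most `1` minus the trace on `F`, and the trace of `A` on `F` is compared with
that of `B`. -/
theorem sum_norm_sub_apply_sq_le (hA : IsSubunitCov e A) (hB : IsSubunitCov e B) {F G : Finset ι}
    (hFG : Disjoint F G) :
    ∑ i ∈ G, ‖(A - B) (e i)‖ ^ 2 ≤
      2 * ∑ i ∈ F, |inner ℝ ((A - B) (e i)) (e i)| +
        4 * (1 - ∑ i ∈ F, inner ℝ (B (e i)) (e i)) := by
  classical
  have htail : ∀ {T : H →L[ℝ] H}, IsSubunitCov e T →
      ∑ i ∈ G, inner ℝ (T (e i)) (e i) ≤ 1 - ∑ i ∈ F, inner ℝ (T (e i)) (e i) := by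
    intro T hT
    have := hT.trace_le (F ∪ G)
    rw [Finset.sum_union hFG] at this
    linarith
  have hpt : ∀ i, ‖(A - B) (e i)‖ ^ 2 ≤
      2 * (inner ℝ (A (e i)) (e i) + inner ℝ (B (e i)) (e i)) := by
    intro i
    have h1 := parallelogram_law_with_norm ℝ (A (e i)) (B (e i))
    rw [sub_apply]
    nlinarith [hA.norm_sq_le (e i), hB.norm_sq_le (e i), norm_nonneg (A (e i) + B (e i))]
  have hdiff : ∑ i ∈ F, inner ℝ (B (e i)) (e i) - ∑ i ∈ F, inner ℝ (A (e i)) (e i) ≤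
      ∑ i ∈ F, |inner ℝ ((A - B) (e i)) (e i)| := by
    rw [← Finset.sum_sub_distrib]
    refine Finset.sum_le_sum fun i _ => ?_
    rw [sub_apply, inner_sub_left, abs_sub_comm]
    exact le_abs_self _
  have hsum := Finset.sum_le_sum fun i (_ : i ∈ G) => hpt i
  rw [← Finset.mul_sum, Finset.sum_add_distrib] at hsum
  linarith [htail hA, htail hB]

/-- By Parseval, only the entries `(i, j)` with `i ∈ F`, `j ∉ F` remain beyond the block. By
symmetry they belong to the columns `j ∉ F`, bounded by Bessel and the preceding lemma. -/
theorem sum_norm_sub_apply_sq_le_entries (hA : IsSubunitCov e A) (hB : IsSubunitCov e B)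
    (F : Finset ι) :
    ∑ i ∈ F, ‖(A - B) (e i)‖ ^ 2 ≤
      ∑ i ∈ F, ∑ j ∈ F, inner ℝ ((A - B) (e i)) (e j) ^ 2 +
      (2 * ∑ i ∈ F, |inner ℝ ((A - B) (e i)) (e i)| +
        4 * (1 - ∑ i ∈ F, inner ℝ (B (e i)) (e i))) := by
  classical
  have hlim : HasSum (fun j => ∑ i ∈ F, inner ℝ ((A - B) (e i)) (e j) ^ 2)
      (∑ i ∈ F, ‖(A - B) (e i)‖ ^ 2) := by
    refine hasSum_sum fun i _ => ?_
    rw [← real_inner_self_eq_norm_sq]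
    refine (e.hasSum_inner_mul_inner ((A - B) (e i)) ((A - B) (e i))).congr_fun ?_
    intro j
    rw [real_inner_comm ((A - B) (e i)) (e j), sq]
  refine le_of_tendsto hlim ?_
  filter_upwards [eventually_ge_atTop F] with G hG
  rw [← Finset.sum_sdiff hG, add_comm]
  have hcomm : ∑ j ∈ F, ∑ i ∈ F, inner ℝ ((A - B) (e i)) (e j) ^ 2 =
      ∑ i ∈ F, ∑ j ∈ F, inner ℝ ((A - B) (e i)) (e j) ^ 2 := Finset.sum_comm
  rw [hcomm]
  gcongr
  refine le_trans (Finset.sum_le_sum fun j _ => ?_)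
    (sum_norm_sub_apply_sq_le hA hB (Finset.disjoint_sdiff (s := F) (t := G)))
  refine le_trans (Finset.sum_le_sum fun i _ => ?_)
    (e.orthonormal.sum_inner_products_le ((A - B) (e j)) (s := F))
  rw [Real.norm_eq_abs, sq_abs, sub_apply, sub_apply,
    inner_sub_left, inner_sub_right, hA.symm (e i) (e j), hB.symm (e i) (e j),
    real_inner_comm (e i), real_inner_comm (e i)]

/-- The Hilbert–Schmidt distance of two covariance operators is controlled by finitely many matrix
entries. -/
theorem hsNorm_sub_le (hA : IsSubunitCov e A) (hB : IsSubunitCov e B) (F : Finset ι) :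
    hsNorm e (A - B) ≤ ENNReal.ofReal
      (∑ i ∈ F, ∑ j ∈ F, inner ℝ ((A - B) (e i)) (e j) ^ 2 +
        4 * ∑ i ∈ F, |inner ℝ ((A - B) (e i)) (e i)| +
        8 * (1 - ∑ i ∈ F, inner ℝ (B (e i)) (e i))) ^ (1 / 2 : ℝ) := by
  classical
  refine ENNReal.rpow_le_rpow ?_ (by norm_num)
  rw [ENNReal.tsum_eq_iSup_sum]
  refine iSup_le fun G => ?_
  have h : ∑ i ∈ G, ‖(A - B) (e i)‖ₑ ^ 2 = ENNReal.ofReal (∑ i ∈ G, ‖(A - B) (e i)‖ ^ 2) := by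
    rw [ENNReal.ofReal_sum_of_nonneg fun i _ => sq_nonneg _]
    refine Finset.sum_congr rfl fun i _ => ?_
    rw [ENNReal.ofReal_pow (norm_nonneg _), ofReal_norm]
  rw [h]
  refine ENNReal.ofReal_le_ofReal ?_
  -- The off-block bound is spent twice, for columns outside `F` and for the remainder of columns in
  -- `F`; hence the constants `4` and `8`.
  have h1 := sum_norm_sub_apply_sq_le hA hB (Finset.disjoint_sdiff (s := F) (t := G))
  have h2 := sum_norm_sub_apply_sq_le_entries hA hB F
  have h3 : ∑ i ∈ G, ‖(A - B) (e i)‖ ^ 2 ≤ ∑ i ∈ F ∪ G, ‖(A - B) (e i)‖ ^ 2 :=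
    Finset.sum_le_sum_of_subset_of_nonneg Finset.subset_union_right fun _ _ _ => sq_nonneg _
  rw [← Finset.union_sdiff_self_eq_union, Finset.sum_union Finset.disjoint_sdiff] at h3
  linarith

end HilbertSchmidt

/-! ### Empirical and limit covariance operators -/

section Covariance

variable {H : Type*} [NormedAddCommGroup H] [InnerProductSpace ℝ H]

theorem inner_tensorSq_apply (h x y : H) :
    inner ℝ (tensorSq h x) y = inner ℝ h x * inner ℝ h y := by
  rw [tensorSq, InnerProductSpace.rankOne_apply, real_inner_smul_left]

theorem inner_sq_le_norm_sq {h : H} (hh : ‖h‖ ≤ 1) (x : H) :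
    inner ℝ h x * inner ℝ h x ≤ ‖x‖ ^ 2 := by
  rw [← sq, sq_le_sq, abs_norm]
  exact (abs_real_inner_le_norm h x).trans (mul_le_of_le_one_left (norm_nonneg _) hh)

theorem sum_inner_mul_self_le_one {ι : Type*} {v : ι → H} (hv : Orthonormal ℝ v) {h : H}
    (hh : ‖h‖ ≤ 1) (F : Finset ι) : ∑ i ∈ F, inner ℝ h (v i) * inner ℝ h (v i) ≤ 1 := by
  refine le_trans (le_of_eq ?_) ((hv.sum_inner_products_le h (s := F)).trans
    (pow_le_one₀ (norm_nonneg _) hh))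
  refine Finset.sum_congr rfl fun i _ => ?_
  rw [Real.norm_eq_abs, sq_abs, sq, real_inner_comm h]

theorem inner_empCov_apply {n : ℕ} (x : Fin n → H) (σ : Equiv.Perm (Fin n)) (k : ℕ) (y z : H) :
    inner ℝ (empCov x σ k y) z = (k : ℝ)⁻¹ *
      ∑ i ∈ Finset.univ.filter (fun i : Fin n => i.val < k),
        inner ℝ (angle (x (σ i))) y * inner ℝ (angle (x (σ i))) z := by
  rw [empCov, smul_apply, real_inner_smul_left, sum_apply,
    sum_inner]
  simp only [inner_tensorSq_apply]

theorem inv_mul_sum_top_le {n k : ℕ} {c : ℝ} (hc : 0 ≤ c) {g : Fin n → ℝ} (hg : ∀ i, g i ≤ c) :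
    (k : ℝ)⁻¹ * ∑ i ∈ Finset.univ.filter (fun i : Fin n => i.val < k), g i ≤ c := by
  refine inv_mul_le_of_le_mul₀ (Nat.cast_nonneg k) hc ?_
  refine (Finset.sum_le_card_nsmul _ _ c fun i _ => hg i).trans ?_
  rw [nsmul_eq_mul, Fin.card_filter_val_lt]
  gcongr
  exact min_le_right _ _

theorem isSubunitCov_empCov {ι : Type*} (e : HilbertBasis ι ℝ H) {n : ℕ} (x : Fin n → H)
    (σ : Equiv.Perm (Fin n)) (k : ℕ) : IsSubunitCov e (empCov x σ k) where
  symm y z := by simp only [inner_empCov_apply, mul_comm]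
  nonneg y := by
    rw [inner_empCov_apply]
    exact mul_nonneg (by positivity) (Finset.sum_nonneg fun i _ => mul_self_nonneg _)
  le y := by
    rw [inner_empCov_apply]
    exact inv_mul_sum_top_le (sq_nonneg _) fun i => inner_sq_le_norm_sq (norm_angle_le_one _) y
  trace_le F := by
    simp only [inner_empCov_apply]
    rw [← Finset.mul_sum, Finset.sum_comm]
    exact inv_mul_sum_top_le zero_le_one fun i =>
      sum_inner_mul_self_le_one e.orthonormal (norm_angle_le_one _) F

/-- The function `θ ↦ ⟪θ, x⟫ ⟪θ, y⟫` truncated at `±1`. -/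
noncomputable def truncInnerMul (x y : H) : H →ᵇ ℝ :=
  BoundedContinuousFunction.ofNormedAddCommGroup
    (fun θ => max (-1) (min 1 (inner ℝ θ x * inner ℝ θ y))) (by fun_prop) 1 fun θ => by
      rw [Real.norm_eq_abs, abs_le]
      exact ⟨le_max_left _ _, max_le (by norm_num) (min_le_left _ _)⟩

theorem abs_truncInnerMul_le (x y θ : H) : |truncInnerMul x y θ| ≤ 1 :=
  abs_le.2 ⟨le_max_left _ _, max_le (by norm_num) (min_le_left _ _)⟩

/-- Weak convergence requires bounded test functions; on the unit ball, which contains all angles,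
the truncation is inactive. -/
theorem truncInnerMul_apply {x y θ : H} (hx : ‖x‖ = 1) (hy : ‖y‖ = 1) (hθ : ‖θ‖ ≤ 1) :
    truncInnerMul x y θ = inner ℝ θ x * inner ℝ θ y := by
  have h : |inner ℝ θ x * inner ℝ θ y| ≤ 1 := by
    rw [abs_mul]
    refine mul_le_one₀ ?_ (abs_nonneg _) ?_
    · exact (abs_real_inner_le_norm θ x).trans (by rwa [hx, mul_one])
    · exact (abs_real_inner_le_norm θ y).trans (by rwa [hy, mul_one])
  rw [abs_le] at h
  change max (-1) (min 1 _) = _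
  rw [min_eq_right h.2, max_eq_right h.1]

theorem continuous_tensorSq : Continuous (tensorSq : H → H →L[ℝ] H) := by
  have h : (tensorSq : H → H →L[ℝ] H) = fun x => (innerSL ℝ x).smulRight x :=
    funext fun x => InnerProductSpace.rankOne_def x x
  rw [h]
  exact isBoundedBilinearMap_smulRight.continuous.comp
    ((innerSL ℝ).continuous.prodMk continuous_id)

variable [MeasurableSpace H] [BorelSpace H] {Q : Measure H}

theorem integrable_inner_mul_inner [IsFiniteMeasure Q] (hQ : ∀ᵐ θ ∂Q, ‖θ‖ ≤ 1) (x y : H) :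
    Integrable (fun θ => inner ℝ θ x * inner ℝ θ y) Q := by
  refine Integrable.of_bound (C := ‖x‖ * ‖y‖) ?_ ?_
  · exact Continuous.aestronglyMeasurable (by fun_prop)
  · filter_upwards [hQ] with θ hθ
    rw [norm_mul]
    gcongr
    · exact (norm_inner_le_norm θ x).trans (mul_le_of_le_one_left (norm_nonneg _) hθ)
    · exact (norm_inner_le_norm θ y).trans (mul_le_of_le_one_left (norm_nonneg _) hθ)

variable [SecondCountableTopology H] [CompleteSpace H]

theorem inner_covOp_apply [IsFiniteMeasure Q] (hQ : ∀ᵐ θ ∂Q, ‖θ‖ ≤ 1) (x y : H) :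
    inner ℝ (covOp Q x) y = ∫ θ, inner ℝ θ x * inner ℝ θ y ∂Q := by
  have hint : Integrable (tensorSq : H → H →L[ℝ] H) Q := by
    refine Integrable.of_bound (C := 1) continuous_tensorSq.aestronglyMeasurable ?_
    filter_upwards [hQ] with θ hθ
    rw [tensorSq, InnerProductSpace.norm_rankOne]
    exact mul_le_one₀ hθ (norm_nonneg _) hθ
  rw [covOp, ContinuousLinearMap.integral_apply hint, real_inner_comm,
    ← integral_inner (hint.apply_continuousLinearMap x)]
  refine integral_congr_ae (ae_of_all _ fun θ => ?_)
  beta_reduce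
  rw [real_inner_comm, inner_tensorSq_apply]

theorem isSubunitCov_covOp [IsProbabilityMeasure Q] (hQ : ∀ᵐ θ ∂Q, ‖θ‖ ≤ 1) {ι : Type*}
    (e : HilbertBasis ι ℝ H) : IsSubunitCov e (covOp Q) where
  symm y z := by simp only [inner_covOp_apply hQ, mul_comm]
  nonneg y := by
    rw [inner_covOp_apply hQ]
    exact integral_nonneg fun θ => mul_self_nonneg _
  le y := by
    rw [inner_covOp_apply hQ]
    refine (integral_mono_ae (integrable_inner_mul_inner hQ y y) (integrable_const (‖y‖ ^ 2))
      ?_).trans_eq (by simp)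
    filter_upwards [hQ] with θ hθ using inner_sq_le_norm_sq hθ y
  trace_le F := by
    simp only [inner_covOp_apply hQ]
    rw [← integral_finsetSum _ fun i _ => integrable_inner_mul_inner hQ _ _]
    refine (integral_mono_ae (integrable_finsetSum _ fun i _ => integrable_inner_mul_inner hQ _ _)
      (integrable_const (1 : ℝ)) ?_).trans_eq (by simp)
    filter_upwards [hQ] with θ hθ using sum_inner_mul_self_le_one e.orthonormal hθ F

/-- Parseval gives `‖θ‖² = 1` almost surely, integrated term by term. The exact value `1` is what
prevents escape of mass. -/
theorem hasSum_trace_covOp [IsProbabilityMeasure Q] (hQ : ∀ᵐ θ ∂Q, ‖θ‖ = 1) {ι : Type*}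
    (e : HilbertBasis ι ℝ H) : HasSum (fun i => inner ℝ (covOp Q (e i)) (e i)) 1 := by
  have hQ' : ∀ᵐ θ ∂Q, ‖θ‖ ≤ 1 := hQ.mono fun _ h => h.le
  have := e.orthonormal.countable_index
  have hsum : ∀ θ : H, HasSum (fun i => inner ℝ θ (e i) * inner ℝ θ (e i)) (‖θ‖ ^ 2) := by
    intro θ
    rw [← real_inner_self_eq_norm_sq]
    refine (e.hasSum_inner_mul_inner θ θ).congr_fun fun i => ?_
    rw [real_inner_comm θ (e i)]
  simp only [inner_covOp_apply hQ']
  have h := hasSum_integral_of_dominated_convergence (μ := Q)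
    (F := fun i θ => inner ℝ θ (e i) * inner ℝ θ (e i)) (f := fun _ => (1 : ℝ))
    (fun i θ => inner ℝ θ (e i) * inner ℝ θ (e i))
    (fun i => (integrable_inner_mul_inner hQ' _ _).aestronglyMeasurable)
    (fun i => ae_of_all _ fun θ => (Real.norm_of_nonneg (mul_self_nonneg _)).le)
    (ae_of_all _ fun θ => (hsum θ).summable) ?_ ?_
  · simpa using h
  · refine (integrable_const (1 : ℝ)).congr ?_
    filter_upwards [hQ] with θ hθ
    rw [(hsum θ).tsum_eq, hθ, one_pow]
  · filter_upwards [hQ] with θ hθ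
    simpa [hθ] using hsum θ

end Covariance

/-! ### Consistency in Hilbert–Schmidt norm -/

theorem mainTheorem10
    {H : Type*} [NormedAddCommGroup H] [InnerProductSpace ℝ H] [CompleteSpace H]
    [SecondCountableTopology H] [MeasurableSpace H] [BorelSpace H]
    {Ω : Type*} [MeasurableSpace Ω] (P : Measure Ω) [IsProbabilityMeasure P]
    (ν : Measure H) (α : ℝ) (hα : 0 < α) (hν : IsRegularlyVarying ν α)
    (X : ℕ → Ω → H) (hlaw : ∀ i, HasLaw (X i) ν P) (hindep : iIndepFun X P) :
    ∃ Q : Measure H, IsLimitAngularMeasure ν Q ∧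
      ∀ {ι : Type*} (e : HilbertBasis ι ℝ H)
        (σ : (n : ℕ) → Ω → Equiv.Perm (Fin n)),
        (∀ n ω, OrdersByNorm (fun i : Fin n => X i ω) (σ n ω)) →
        ∀ n k : ℕ → ℕ, Tendsto n atTop atTop → Tendsto k atTop atTop →
          Tendsto (fun j => (k j : ℝ) / (n j : ℝ)) atTop (𝓝 0) →
          ∀ ε : ℝ, 0 < ε →
            Tendsto
              (fun j => P {ω | ENNReal.ofReal ε ≤
                hsNorm e (empCov (fun i : Fin (n j) => X i ω) (σ (n j) ω) (k j) - covOp Q)})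
              atTop (𝓝 0) := by
  have hν1 : IsProbabilityMeasure ν := (hlaw 0).isProbabilityMeasure_iff.1 inferInstance
  obtain ⟨⟨Q, hQ⟩, hV0, hVr⟩ := hν.exists_isLimitAngularMeasure
  refine ⟨Q, hQ, ?_⟩
  intro ι e σ hσ n k hn hk hkn ε hε
  have hQ1 := hQ.1
  have hsphere : ∀ᵐ θ ∂Q, ‖θ‖ = 1 := by
    filter_upwards [measure_eq_zero_iff_ae_notMem.1 hQ.2.1] with θ hθ
    simpa using hθ
  have hball : ∀ᵐ θ ∂Q, ‖θ‖ ≤ 1 := hsphere.mono fun _ h => h.le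
  have hentry : ∀ (i j : ι) (δ : ℝ), 0 < δ → Tendsto (fun m => P {ω | δ ≤
      |inner ℝ ((empCov (fun i : Fin (n m) => X i ω) (σ (n m) ω) (k m) - covOp Q) (e i)) (e j)|})
      atTop (𝓝 0) := by
    intro i j δ hδ
    have hi := e.orthonormal.1 i
    have hj := e.orthonormal.1 j
    refine (tendsto_measure_mean_top_angle_sub hlaw hindep hQ hV0 hVr hσ
      (abs_truncInnerMul_le (e i) (e j)) hn hk hkn hδ).congr fun m => ?_
    have hint : ∫ θ, truncInnerMul (e i) (e j) θ ∂Q = inner ℝ (covOp Q (e i)) (e j) := by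
      rw [inner_covOp_apply hball]
      exact integral_congr_ae (hball.mono fun θ hθ => truncInnerMul_apply hi hj hθ)
    simp only [hint, truncInnerMul_apply hi hj (norm_angle_le_one _), sub_apply,
      inner_sub_left, inner_empCov_apply]
  -- The bound in `hsNorm_sub_le` must stay below `ε ^ 2`: the trace defect, with factor `8`, uses
  -- less than `ε ^ 2 / 2`, and `δ` is chosen so that the entries use less than the other half.
  obtain ⟨F, hF⟩ : ∃ F : Finset ι,
      1 - ε ^ 2 / 16 < ∑ i ∈ F, inner ℝ (covOp Q (e i)) (e i) :=
    ((hasSum_trace_covOp hsphere e).eventually_const_lt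
      (show 1 - ε ^ 2 / 16 < 1 by linarith [pow_pos hε 2])).exists
  obtain ⟨δ, hδ, hδε⟩ : ∃ δ : ℝ, 0 < δ ∧
      (F.card : ℝ) ^ 2 * δ ^ 2 + 4 * (F.card * δ) < ε ^ 2 / 2 := by
    have hlim : Tendsto (fun δ : ℝ => (F.card : ℝ) ^ 2 * δ ^ 2 + 4 * (F.card * δ)) (𝓝 0) (𝓝 0) := by
      have : Continuous fun δ : ℝ => (F.card : ℝ) ^ 2 * δ ^ 2 + 4 * (F.card * δ) := by fun_prop
      simpa using this.tendsto 0
    obtain ⟨δ, h1, h2⟩ := (((hlim.eventually_lt_const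
      (show 0 < ε ^ 2 / 2 by positivity)).filter_mono nhdsWithin_le_nhds).and
      (self_mem_nhdsWithin (s := Set.Ioi 0))).exists
    exact ⟨δ, h2, h1⟩
  have hlim := tendsto_finsetSum (F ×ˢ F) fun p _ => hentry p.1 p.2 δ hδ
  rw [Finset.sum_const_zero] at hlim
  refine tendsto_of_tendsto_of_tendsto_of_le_of_le tendsto_const_nhds hlim (fun _ => zero_le)
    fun m => ?_
  -- A large Hilbert–Schmidt distance forces some entry of the finite block to be at least `δ`; a
  -- union bound concludes.
  refine (measure_mono fun ω hω => ?_).trans (measure_biUnion_finset_le (F ×ˢ F) _)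
  simp only [Set.mem_iUnion, Set.mem_ofPred_eq, exists_prop] at hω ⊢
  by_contra! h
  set A := empCov (fun i : Fin (n m) => X i ω) (σ (n m) ω) (k m) with hA
  have hlt : ∀ i ∈ F, ∀ j ∈ F, |inner ℝ ((A - covOp Q) (e i)) (e j)| < δ := fun i hi j hj =>
    h (i, j) (Finset.mem_product.2 ⟨hi, hj⟩)
  have hle := hω.trans (hsNorm_sub_le (isSubunitCov_empCov e _ _ _) (isSubunitCov_covOp hball e) F)
  rw [← hA] at hle
  have h1 : ∑ i ∈ F, ∑ j ∈ F, inner ℝ ((A - covOp Q) (e i)) (e j) ^ 2 ≤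
      (F.card : ℝ) ^ 2 * δ ^ 2 := by
    calc _ ≤ ∑ i ∈ F, ∑ j ∈ F, δ ^ 2 := by
          refine Finset.sum_le_sum fun i hi => Finset.sum_le_sum fun j hj => ?_
          rw [← sq_abs]
          exact pow_le_pow_left₀ (abs_nonneg _) (hlt i hi j hj).le 2
      _ = _ := by simp only [Finset.sum_const, nsmul_eq_mul]; ring
  have h2 : ∑ i ∈ F, |inner ℝ ((A - covOp Q) (e i)) (e i)| ≤ F.card * δ := by
    refine (Finset.sum_le_card_nsmul _ _ δ fun i hi => (hlt i hi i hi).le).trans_eq ?_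
    rw [nsmul_eq_mul]
  refine absurd hle (not_le.2 ?_)
  have hroot : ENNReal.ofReal ε = ENNReal.ofReal (ε ^ 2) ^ (1 / 2 : ℝ) := by
    rw [ENNReal.ofReal_rpow_of_pos (pow_pos hε 2), ← Real.sqrt_eq_rpow, Real.sqrt_sq hε.le]
  rw [hroot]
  exact ENNReal.rpow_lt_rpow ((ENNReal.ofReal_lt_ofReal_iff (pow_pos hε 2)).2 (by linarith))
    (by norm_num)
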